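/- A plank in $\mathbb{R}^d$ is the closed region between two distinct parallel hyperplanes, and its width is the distance between them. A convex body in $\mathbb{R}^d$ is a compact convex set with nonempty interior. The minimal width $w(K)$ of a convex body $K$ is the smallest width of a plank containing $K$; a unit vector $u$ is a minimal width direction of $K$ if it is normal to a plank of width $w(K)$ containing $K$. For a unit vector $u$ let $h_K(u)=\max_{x\in K}\langle x,u\rangle$ and $H_K(u)=\{x\in\mathbb{R}^d : \langle x,u\rangle=h_K(u)\}$; for $x\in\partial K$ let $T_K(x)=\mathrm{cl}\{x+\alpha(y-x) : y\in K,\ \alpha\ge 0\}$. The body $K$ is spiky in direction $u$ if $K\cap H_K(u)$ is a single point $x\in\partial K$ and $T_K(x)\cap H_K(u)=\{x\}$. Theorem. Let $d\in\{2,3\}$ and let $K\subset\mathbb{R}^d$ be a convex body that is spiky in some minimal width direction. Then for every $\varepsilon\in(0,1)$ there exists $y\in\mathbb{R}^d$ such that $\varepsilon K+y\subset\mathrm{int}\,K$ and the annulus $K\setminus(\varepsilon K+y)$ can be covered by finitely many planks of total width strictly less than $w(K)$. -/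

import Mathlib

/-- A plank of `ℝ^d`: the closed region between two distinct parallel hyperplanes
`⟪normal, x⟫ = lower` and `⟪normal, x⟫ = upper`, with a unit normal vector. -/
structure Plank (d : ℕ) where
  normal : EuclideanSpace ℝ (Fin d)
  lower : ℝ
  upper : ℝ
  norm_normal : ‖normal‖ = 1
  lower_lt_upper : lower < upper

namespace Plank

/-- The closed region of points of the plank. -/
def region {d : ℕ} (P : Plank d) : Set (EuclideanSpace ℝ (Fin d)) :=
  {x | P.lower ≤ inner ℝ P.normal x ∧ inner ℝ P.normal x ≤ P.upper}

/-- The distance between the two bounding hyperplanes (the normal is a unit vector). -/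
def width {d : ℕ} (P : Plank d) : ℝ := P.upper - P.lower

end Plank

/-- The minimal width of `K`: the infimum of the widths of single planks covering `K`. -/
noncomputable def minimalWidth {d : ℕ} (K : Set (EuclideanSpace ℝ (Fin d))) : ℝ :=
  sInf {w : ℝ | ∃ P : Plank d, K ⊆ P.region ∧ P.width = w}

/-- `P` is a minimal width plank of `K`. -/
def IsMinimalWidthPlank {d : ℕ} (K : Set (EuclideanSpace ℝ (Fin d))) (P : Plank d) : Prop :=
  K ⊆ P.region ∧ P.width = minimalWidth K

/-- `u` is a minimal width direction of `K`: a unit normal of a minimal width plank of `K`. -/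
def IsMinimalWidthDirection {d : ℕ} (K : Set (EuclideanSpace ℝ (Fin d)))
    (u : EuclideanSpace ℝ (Fin d)) : Prop :=
  ∃ P : Plank d, IsMinimalWidthPlank K P ∧ P.normal = u

/-- The support function `h_K(u) = max_{x ∈ K} ⟪x, u⟫`. -/
noncomputable def supportFunction {d : ℕ} (K : Set (EuclideanSpace ℝ (Fin d)))
    (u : EuclideanSpace ℝ (Fin d)) : ℝ :=
  sSup ((fun x => inner ℝ x u) '' K)

/-- The supporting hyperplane `H_K(u)` of `K` with outer normal `u`. -/
def supportingHyperplane {d : ℕ} (K : Set (EuclideanSpace ℝ (Fin d)))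
    (u : EuclideanSpace ℝ (Fin d)) : Set (EuclideanSpace ℝ (Fin d)) :=
  {x | inner ℝ x u = supportFunction K u}

/-- The tangent cone `T_K(x) = cl {x + α (y - x) | y ∈ K, α ≥ 0}`, with apex at `x`. -/
def tangentConeOf {d : ℕ} (K : Set (EuclideanSpace ℝ (Fin d)))
    (x : EuclideanSpace ℝ (Fin d)) : Set (EuclideanSpace ℝ (Fin d)) :=
  closure {z | ∃ y ∈ K, ∃ α : ℝ, 0 ≤ α ∧ z = x + α • (y - x)}

/-- `K` is spiky in the unit direction `u`. -/
def IsSpiky {d : ℕ} (K : Set (EuclideanSpace ℝ (Fin d)))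
    (u : EuclideanSpace ℝ (Fin d)) : Prop :=
  ‖u‖ = 1 ∧ ∃ x ∈ frontier K, K ∩ supportingHyperplane K u = {x} ∧
    tangentConeOf K x ∩ supportingHyperplane K u = {x}

/-- The homothetic copy `ε K + y` of `K`. -/
def homotheticCopy {d : ℕ} (K : Set (EuclideanSpace ℝ (Fin d))) (ε : ℝ)
    (y : EuclideanSpace ℝ (Fin d)) : Set (EuclideanSpace ℝ (Fin d)) :=
  (fun x => ε • x + y) '' K

/-! Move the tip of the spike to the origin and measure depth along the inner normal `-u`. Spikiness
and compactness bound the norm of a point of the body by a multiple of its depth, so the interior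
directions, normalised to depth one, form a bounded convex set `C` in a line or plane. There `C` is
the hull of a finite set `F` up to strips of total width below `1/2`. Extended linearly from the
slice, each strip becomes a plank whose relevant width is proportional to depth, so strips for
depths up to `t` cost less than `t / 2`.

Push the copy inwards by `σ • p`, with `x + p` interior. As `F` is finite, one scale `δ` works for
the whole hull: every point of depth between `σ / δ` and `t` whose direction lies in the hull is in
the copy. Depths at least `t` need a plank of width `w - t`, because `u` is a minimal width
direction; depths at most `σ / δ ≤ t / 4` need one more. The total is below `w - t + t / 4 + t / 2`.

The dimension enters through the slice. For a segment two short end strips suffice. For a planar set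
the caps cut off by an equidistant polygon have heights bounded by second differences, whose sum
telescopes to two small boundary terms. -/

/-! ### Planar convex sets: inscribed polygons and thin strips -/

/-- Chord inequality for a function selecting nearly lowest points of the fibres of a convex set. -/
lemma near_lower_chord {C : Set (ℝ × ℝ)} (hC : Convex ℝ C) {g κ q : ℝ}
    (hg : ∀ y, (q, y) ∈ C → g ≤ y + κ) {p r yp yr : ℝ} (hp : (p, yp) ∈ C) (hr : (r, yr) ∈ C)
    (hpq : p ≤ q) (hqr : q ≤ r) (hpr : p < r) :
    (r - p) * g ≤ (r - q) * yp + (q - p) * yr + κ * (r - p) := by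
  have h0 : 0 < r - p := by linarith
  have hmem := hC hp hr (a := (r - q) / (r - p)) (b := (q - p) / (r - p))
    (div_nonneg (by linarith) h0.le) (div_nonneg (by linarith) h0.le) (by field_simp; ring)
  have heq : ((r - q) / (r - p)) • (p, yp) + ((q - p) / (r - p)) • (r, yr) =
      (q, ((r - q) * yp + (q - p) * yr) / (r - p)) := by
    ext
    · simp; field_simp; ring
    · simp; field_simp
  rw [heq] at hmem
  have := hg _ hmem
  calc (r - p) * g ≤ (r - p) * (((r - q) * yp + (q - p) * yr) / (r - p) + κ) :=
        mul_le_mul_of_nonneg_left this h0.le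
    _ = _ := by field_simp

/-- The chord through two consecutive near-lowest points lies only slightly above the set, with
an error controlled by a second difference. -/
lemma chord_sub_le {C : Set (ℝ × ℝ)} (hC : Convex ℝ C) {κ δ x Y₀ Y₁ Y₂ : ℝ}
    (hδ : 0 < δ) (h₀ : (x - δ, Y₀) ∈ C) (h₂ : (x + δ, Y₂) ∈ C) (hκ : 0 < κ)
    (hg : ∀ y, (x, y) ∈ C → Y₁ ≤ y + κ) :
    0 < 4 * κ + (Y₂ - 2 * Y₁ + Y₀) ∧
      ∀ s y, (s, y) ∈ C → x ≤ s → s ≤ x + δ →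
        Y₁ + (Y₂ - Y₁) / δ * (s - x) - y ≤ 4 * κ + (Y₂ - 2 * Y₁ + Y₀) := by
  have hsec : -(2 * κ) ≤ Y₂ - 2 * Y₁ + Y₀ := by
    have := near_lower_chord hC hg h₀ h₂ (by linarith) (by linarith) (by linarith)
    have h2 : δ * (2 * Y₁) ≤ δ * (Y₂ + Y₀ + 2 * κ) := by linarith
    have := le_of_mul_le_mul_left h2 hδ
    linarith
  refine ⟨by linarith, fun s y hs hxs hsx => ?_⟩
  obtain ⟨θ, rfl⟩ : ∃ θ, s = x + θ * δ := ⟨(s - x) / δ, by field_simp; ring⟩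
  have hθ0 : 0 ≤ θ := by
    by_contra h
    nlinarith
  have hθ1 : θ ≤ 1 := by
    by_contra h
    nlinarith
  -- The chord from `x - δ` to `s` passes over `x`, which bounds `y` from below by extrapolation.
  have h1 := near_lower_chord hC hg h₀ hs (by linarith) hxs (by linarith)
  have h2 : δ * ((1 + θ) * Y₁) ≤ δ * (θ * Y₀ + y + κ * (1 + θ)) := by linarith
  have h3 := le_of_mul_le_mul_left h2 hδ
  have h4 : (Y₂ - Y₁) / δ * (x + θ * δ - x) = (Y₂ - Y₁) * θ := by field_simp; ring
  rw [h4]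
  -- The second difference can be as low as `-2κ`; adding `2κ` makes it nonnegative, so `θ ≤ 1` can
  -- be used.
  have h5 : θ * (Y₂ - 2 * Y₁ + Y₀ + 2 * κ) ≤ 1 * (Y₂ - 2 * Y₁ + Y₀ + 2 * κ) :=
    mul_le_mul_of_nonneg_right hθ1 (by linarith)
  nlinarith [mul_nonneg hθ0 hκ.le]

lemma exists_mem_fiber_of_convex {C : Set (ℝ × ℝ)} (hC : Convex ℝ C) {p r yp yr s : ℝ}
    (hp : (p, yp) ∈ C) (hr : (r, yr) ∈ C) (hps : p ≤ s) (hsr : s ≤ r) : ∃ y, (s, y) ∈ C := by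
  rcases hps.eq_or_lt with rfl | hps
  · exact ⟨yp, hp⟩
  have h0 : 0 < r - p := by linarith
  have hmem := hC hp hr (a := (r - s) / (r - p)) (b := (s - p) / (r - p))
    (div_nonneg (by linarith) h0.le) (div_nonneg (by linarith) h0.le) (by field_simp; ring)
  have heq : ((r - s) / (r - p)) • (p, yp) + ((s - p) / (r - p)) • (r, yr) =
      (s, (r - s) / (r - p) * yp + (s - p) / (r - p) * yr) := by
    ext
    · simp; field_simp; ring
    · simp
  exact ⟨_, heq ▸ hmem⟩

/-- A selection of nearly lowest points in the fibres of a convex planar set. -/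
lemma exists_near_lower_selection {C : Set (ℝ × ℝ)} (hC : Convex ℝ C) {M : ℝ}
    (hM : ∀ z ∈ C, |z.2| ≤ M) {p r yp yr κ : ℝ} (hp : (p, yp) ∈ C) (hr : (r, yr) ∈ C)
    (hκ : 0 < κ) :
    ∃ g : ℝ → ℝ, ∀ s, p ≤ s → s ≤ r → (s, g s) ∈ C ∧ ∀ y, (s, y) ∈ C → g s ≤ y + κ := by
  have hsel : ∀ s, ∃ g, p ≤ s → s ≤ r → (s, g) ∈ C ∧ ∀ y, (s, y) ∈ C → g ≤ y + κ := by
    intro s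
    by_cases h : p ≤ s ∧ s ≤ r
    · have hbd : BddBelow {y | (s, y) ∈ C} := ⟨-M, fun y hy => (abs_le.1 (hM _ hy)).1⟩
      obtain ⟨g, hg, hg'⟩ := exists_lt_of_csInf_lt
        (show {y | (s, y) ∈ C}.Nonempty from exists_mem_fiber_of_convex hC hp hr h.1 h.2)
        (show sInf {y | (s, y) ∈ C} < sInf {y | (s, y) ∈ C} + κ by linarith)
      exact ⟨g, fun _ _ => ⟨hg, fun y hy => by linarith [csInf_le hbd hy]⟩⟩
    · exact ⟨0, fun h1 h2 => (h ⟨h1, h2⟩).elim⟩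
  choose g hg using hsel
  exact ⟨g, hg⟩

/-- Slope bound at the ends of the grid: `T` is the change over one step `δ`, `D` the horizontal
room, and `2 * M` the oscillation of the heights. -/
lemma lt_of_mul_le_small {D T δ M η ρ : ℝ} (hη : 0 < η) (hρ : 0 < ρ) (hD : ρ / 2 < D)
    (h : D * T ≤ δ * (2 * M)) (hδ : δ * (16 * M) < ρ * η) : T < η / 4 := by
  by_contra! hT
  nlinarith [mul_lt_mul_of_pos_right hD hη, mul_le_mul_of_nonneg_left hT (by linarith : 0 ≤ D)]

/-- Over a compact subinterval of the interior of its projection, a convex planar set lies above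
the polygon through nearly lowest points over a fine equidistant grid, up to strips of small total
width. -/
lemma exists_lower_polygon_grid {C : Set (ℝ × ℝ)} (hC : Convex ℝ C) {M : ℝ}
    (hM : ∀ z ∈ C, |z.2| ≤ M) {a₁ a₂ b₁ b₂ yA yB ρ η : ℝ} (hA : (a₂, yA) ∈ C)
    (hB : (b₂, yB) ∈ C) (hρ : 0 < ρ) (ha : a₂ + ρ ≤ a₁) (hab : a₁ < b₁) (hb : b₁ + ρ ≤ b₂)
    (hη : 0 < η) :
    ∃ (N : ℕ) (F : Set (ℝ × ℝ)) (α γ h : Fin N → ℝ), F.Finite ∧ F ⊆ C ∧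
      (∀ i, 0 < h i) ∧ ∑ i, h i < η ∧
      ∀ s y, (s, y) ∈ C → a₁ ≤ s → s < b₁ → (∃ y' ≤ y, (s, y') ∈ convexHull ℝ F) ∨
        ∃ i, 0 ≤ α i * s - y + γ i ∧ α i * s - y + γ i ≤ h i := by
  have hyA := abs_le.1 (hM _ hA)
  have hyB := abs_le.1 (hM _ hB)
  simp only at hyA hyB
  have hMnn : 0 ≤ M := by linarith
  obtain ⟨N, δ, κ, hδpos, hκpos, hNδ, hδρ, hδM, hNκ, hκs⟩ : ∃ (N : ℕ) (δ κ : ℝ), 0 < δ ∧ 0 < κ ∧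
      N * δ = b₁ - a₁ ∧ δ < ρ / 2 ∧ δ * (16 * M) < ρ * η ∧ N * κ = η / 16 ∧ κ < η / 16 := by
    have hL : 0 < b₁ - a₁ := by linarith
    obtain ⟨N, hN⟩ := exists_nat_gt ((b₁ - a₁) * (2 / ρ) + (b₁ - a₁) * (16 * M) / (ρ * η) + 1)
    have h1 : 0 ≤ (b₁ - a₁) * (2 / ρ) := by positivity
    have h2 : 0 ≤ (b₁ - a₁) * (16 * M) / (ρ * η) := by positivity
    have hN1 : (1 : ℝ) < N := by linarith
    have hN0 : (0 : ℝ) < N := by linarith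
    refine ⟨N, (b₁ - a₁) / N, η / 16 / N, by positivity, by positivity, by field_simp, ?_, ?_,
      by field_simp, ?_⟩
    · rw [div_lt_iff₀ hN0]
      have h3 : (b₁ - a₁) * (2 / ρ) < N := by linarith
      rw [← mul_div_assoc, div_lt_iff₀ hρ] at h3
      linarith
    · have h3 : (b₁ - a₁) * (16 * M) / (ρ * η) < N := by linarith
      rw [div_lt_iff₀ (by positivity)] at h3
      rw [div_mul_eq_mul_div, div_lt_iff₀ hN0]
      linarith
    · exact div_lt_self (by positivity) hN1
  obtain ⟨g, hg⟩ := exists_near_lower_selection hC hM hA hB hκpos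
  -- The grid starts one step left of `a₁`, so that the first cell `[x 1, x 2]` also has a left
  -- neighbour for its second difference.
  obtain ⟨x, hx⟩ : ∃ x : ℕ → ℝ, ∀ k, x k = a₁ + (k - 1) * δ := ⟨_, fun _ => rfl⟩
  have hxs : ∀ k, x (k + 1) = x k + δ := fun k => by rw [hx, hx]; push_cast; ring
  have hxk : ∀ k : ℕ, x (k + 1) = a₁ + k * δ := fun k => by rw [hx]; push_cast; ring
  have hx1 : x 1 = a₁ := by simp [hx]
  have hx0 : x 0 = a₁ - δ := by simp [hx]; ring
  have hxN : x (N + 1) = b₁ := by rw [hxk]; linarith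
  have hxN' : x N = b₁ - δ := by have := hxs N; linarith
  have hxlo : ∀ k, a₁ - δ ≤ x k := fun k => by
    rw [hx]; nlinarith [mul_nonneg (Nat.cast_nonneg (α := ℝ) k) hδpos.le]
  have hxhi : ∀ k, k ≤ N + 1 → x k ≤ b₁ := fun k hk => by
    rw [← hxN, hx, hx]
    have : (k : ℝ) ≤ (N + 1 : ℕ) := by exact_mod_cast hk
    nlinarith
  obtain ⟨Y, hY⟩ : ∃ Y : ℕ → ℝ, ∀ k, Y k = g (x k) := ⟨_, fun _ => rfl⟩
  have hYp : ∀ k, k ≤ N + 1 → (x k, Y k) ∈ C ∧ ∀ y, (x k, y) ∈ C → Y k ≤ y + κ :=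
    fun k hk => by
      rw [hY]
      exact hg (x k) (by linarith [hxlo k]) (by linarith [hxhi k hk])
  have hYM : ∀ k, k ≤ N + 1 → |Y k| ≤ M := fun k hk => hM _ (hYp k hk).1
  have hcell : ∀ i, i < N → _ := fun i hi =>
    chord_sub_le hC (κ := κ) (δ := δ) (x := x (i + 1)) (Y₀ := Y i) (Y₁ := Y (i + 1))
      (Y₂ := Y (i + 2)) hδpos
      (by have := (hYp i (by omega)).1; rwa [hxs, add_sub_cancel_right])
      (by have := (hYp (i + 2) (by omega)).1; rwa [hxs (i + 1)] at this) hκpos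
      (hYp (i + 1) (by omega)).2
  have hfirst : Y 0 - Y 1 < κ + η / 4 := by
    have h1 := near_lower_chord hC (hYp 0 (by omega)).2 hA (hYp 1 (by omega)).1
      (by linarith) (by linarith) (by linarith)
    rw [hx0, hx1] at h1
    have hy1 := abs_le.1 (hYM 1 (by omega))
    have h2 : (a₁ - a₂) * (Y 0 - Y 1 - κ) ≤ δ * (yA - Y 1) := by linarith
    have h3 : δ * (yA - Y 1) ≤ δ * (2 * M) :=
      mul_le_mul_of_nonneg_left (by linarith) hδpos.le
    linarith [lt_of_mul_le_small hη hρ (by linarith) (h2.trans h3) hδM]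
  have hlast : Y (N + 1) - Y N < κ + η / 4 := by
    have h1 := near_lower_chord hC (hYp (N + 1) (by omega)).2 (hYp N (by omega)).1 hB
      (by linarith) (by linarith) (by linarith)
    rw [hxN', hxN] at h1
    have hyN := abs_le.1 (hYM N (by omega))
    have h2 : (b₂ - (b₁ - δ)) * (Y (N + 1) - Y N - κ) ≤ δ * (yB - Y N) := by linarith
    have h3 : δ * (yB - Y N) ≤ δ * (2 * M) :=
      mul_le_mul_of_nonneg_left (by linarith) hδpos.le
    linarith [lt_of_mul_le_small hη hρ (by linarith) (h2.trans h3) hδM]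
  -- Only the two end differences survive; with `N * κ = η / 16` the total is below `η / 4 + 2 * (κ
  -- + η / 4) < η`.
  have htel : ∀ n, ∑ i ∈ Finset.range n, (4 * κ + (Y (i + 2) - 2 * Y (i + 1) + Y i)) =
      n * (4 * κ) + ((Y (n + 1) - Y n) + (Y 0 - Y 1)) := by
    intro n
    induction n with
    | zero => simp
    | succ n ih => rw [Finset.sum_range_succ, ih]; push_cast; ring
  refine ⟨N, (fun k => (x k, Y k)) '' (Set.Iic (N + 1)),
    fun i => (Y (i + 2) - Y (i + 1)) / δ,
    fun i => Y (i + 1) - (Y (i + 2) - Y (i + 1)) / δ * x (i + 1),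
    fun i => 4 * κ + (Y (i + 2) - 2 * Y (i + 1) + Y i),
    (Set.finite_Iic _).image _, ?_, fun i => (hcell i i.2).1, ?_, ?_⟩
  · rintro _ ⟨k, hk, rfl⟩
    exact (hYp k hk).1
  · rw [Fin.sum_univ_eq_sum_range
      (fun i => 4 * κ + (Y (i + 2) - 2 * Y (i + 1) + Y i)) N, htel]
    linarith
  · intro s y hz h1 h2
    obtain ⟨i, hi, hi1, hi2⟩ : ∃ i, i < N ∧ x (i + 1) ≤ s ∧ s ≤ x (i + 2) := by
      refine ⟨⌊(s - a₁) / δ⌋₊, ?_, ?_, ?_⟩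
      · rw [Nat.floor_lt (div_nonneg (by linarith) hδpos.le), div_lt_iff₀ hδpos, hNδ]
        linarith
      · have := Nat.floor_le (div_nonneg (by linarith : 0 ≤ s - a₁) hδpos.le)
        rw [le_div_iff₀ hδpos] at this
        rw [hxk]; linarith
      · have := (Nat.lt_floor_add_one ((s - a₁) / δ)).le
        rw [div_le_iff₀ hδpos] at this
        rw [hxk]; push_cast; linarith
    have hx2 : x (i + 2) = x (i + 1) + δ := hxs (i + 1)
    have hle := (hcell i hi).2 s y hz hi1 (by rwa [hx2] at hi2)
    rcases le_or_gt (Y (i + 1) + (Y (i + 2) - Y (i + 1)) / δ * (s - x (i + 1))) y with h3 | h3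
    · refine Or.inl ⟨_, h3, ?_⟩
      have hc := convex_convexHull ℝ ((fun k => (x k, Y k)) '' (Set.Iic (N + 1)))
        (subset_convexHull ℝ _ ⟨i + 1, Set.mem_Iic.2 (by omega), rfl⟩)
        (subset_convexHull ℝ _ ⟨i + 2, Set.mem_Iic.2 (by omega), rfl⟩)
        (a := (x (i + 2) - s) / δ) (b := (s - x (i + 1)) / δ)
        (div_nonneg (by linarith) hδpos.le) (div_nonneg (by linarith) hδpos.le)
        (by rw [hx2]; field_simp; ring)
      convert hc using 1
      ext
      · simp only [Prod.smul_mk, Prod.mk_add_mk, smul_eq_mul]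
        rw [hx2]; field_simp; ring
      · simp only [Prod.smul_mk, Prod.mk_add_mk, smul_eq_mul]
        rw [hx2]; field_simp; ring
    · refine Or.inr ⟨⟨i, hi⟩, ?_⟩
      simp only
      constructor <;> linarith

/-- A bounded convex planar set lies above an inscribed polygon, up to finitely many strips of
arbitrarily small total width. -/
lemma exists_lower_polygon {C : Set (ℝ × ℝ)} (hC : Convex ℝ C) {M : ℝ}
    (hM : ∀ z ∈ C, |z.1| ≤ M ∧ |z.2| ≤ M) {η : ℝ} (hη : 0 < η) :
    ∃ (ι : Type) (_ : Fintype ι) (F : Set (ℝ × ℝ)) (α β γ h : ι → ℝ), F.Finite ∧ F ⊆ C ∧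
      (∀ i, 1 ≤ α i ^ 2 + β i ^ 2 ∧ 0 < h i) ∧ ∑ i, h i < η ∧
      ∀ z ∈ C, (∃ y ≤ z.2, (z.1, y) ∈ convexHull ℝ F) ∨
        ∃ i, 0 ≤ α i * z.1 + β i * z.2 + γ i ∧ α i * z.1 + β i * z.2 + γ i ≤ h i := by
  rcases C.eq_empty_or_nonempty with rfl | hne
  · exact ⟨Empty, inferInstance, ∅, fun _ => 0, fun _ => 0, fun _ => 0, fun _ => 0,
      by simp, by simp, by simp, by simpa using hη, by simp⟩
  have hSne : (Prod.fst '' C).Nonempty := hne.image _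
  have hSb : BddBelow (Prod.fst '' C) := ⟨-M, by
    rintro _ ⟨z, hz, rfl⟩
    exact (abs_le.1 (hM z hz).1).1⟩
  have hSa : BddAbove (Prod.fst '' C) := ⟨M, by
    rintro _ ⟨z, hz, rfl⟩
    exact (abs_le.1 (hM z hz).1).2⟩
  obtain ⟨a, ha⟩ : ∃ a, a = sInf (Prod.fst '' C) := ⟨_, rfl⟩
  obtain ⟨b, hb⟩ : ∃ b, b = sSup (Prod.fst '' C) := ⟨_, rfl⟩
  have hab : ∀ z ∈ C, a ≤ z.1 ∧ z.1 ≤ b := fun z hz =>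
    ⟨ha ▸ csInf_le hSb ⟨z, hz, rfl⟩, hb ▸ le_csSup hSa ⟨z, hz, rfl⟩⟩
  rcases lt_or_ge (b - a) (3 * η / 4) with hsmall | hbig
  · refine ⟨Unit, inferInstance, ∅, fun _ => 1, fun _ => 0, fun _ => -a, fun _ => 3 * η / 4,
      Set.finite_empty, by simp, by simp [hη], by simp; linarith, fun z hz => Or.inr ⟨(), ?_⟩⟩
    have := hab z hz
    constructor <;> linarith
  obtain ⟨_, ⟨⟨a₂, yA⟩, hA, rfl⟩, hA'⟩ := exists_lt_of_csInf_lt hSne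
    (show sInf (Prod.fst '' C) < a + η / 8 by rw [← ha]; linarith)
  obtain ⟨_, ⟨⟨b₂, yB⟩, hB, rfl⟩, hB'⟩ := exists_lt_of_lt_csSup hSne
    (show b - η / 8 < sSup (Prod.fst '' C) by rw [← hb]; linarith)
  simp only at hA' hB'
  obtain ⟨N, F, α, γ, h, hF, hFC, hpos, hsum, hcov⟩ := exists_lower_polygon_grid hC
    (fun z hz => (hM z hz).2) hA hB (show 0 < η / 8 by linarith)
    (show a₂ + η / 8 ≤ a + η / 4 by linarith) (show a + η / 4 < b - η / 4 by linarith)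
    (show b - η / 4 + η / 8 ≤ b₂ by linarith) (half_pos hη)
  -- Two vertical strips of width `η / 4` cover the ends, where the lower boundary may be
  -- arbitrarily steep.
  refine ⟨Bool ⊕ Fin N, inferInstance, F, Sum.elim (fun _ => 1) α,
    Sum.elim (fun _ => 0) (fun _ => -1),
    Sum.elim (fun c => if c then -a else -(b - η / 4)) γ,
    Sum.elim (fun _ => η / 4) h, hF, hFC, ?_, ?_, ?_⟩
  · rintro (c | i)
    · simp [hη]
    · refine ⟨?_, hpos i⟩
      simp only [Sum.elim_inr]
      nlinarith [sq_nonneg (α i)]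
  · rw [Fintype.sum_sum_type]
    simp only [Sum.elim_inl, Sum.elim_inr]
    simp only [Finset.sum_const, Finset.card_univ, Fintype.card_bool]
    rw [nsmul_eq_mul]
    push_cast
    linarith
  · rintro ⟨s, y⟩ hz
    have hs := hab _ hz
    simp only at hs ⊢
    rcases le_or_gt s (a + η / 4) with h1 | h1
    · refine Or.inr ⟨Sum.inl true, ?_⟩
      simp only [Sum.elim_inl, if_true]
      constructor <;> linarith
    rcases le_or_gt (b - η / 4) s with h2 | h2
    · refine Or.inr ⟨Sum.inl false, ?_⟩
      simp only [Sum.elim_inl, Bool.false_eq_true, if_false]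
      constructor <;> linarith
    rcases hcov s y hz h1.le h2 with h3 | ⟨i, hi⟩
    · exact Or.inl h3
    · refine Or.inr ⟨Sum.inr i, ?_⟩
      simp only [Sum.elim_inr]
      constructor <;> linarith [hi.1, hi.2]

/-- A bounded convex planar set is covered by an inscribed polygon and finitely many strips of
arbitrarily small total width. -/
lemma exists_polygon_strips {C : Set (ℝ × ℝ)} (hC : Convex ℝ C) {M : ℝ}
    (hM : ∀ z ∈ C, |z.1| ≤ M ∧ |z.2| ≤ M) {η : ℝ} (hη : 0 < η) :
    ∃ (ι : Type) (_ : Fintype ι) (F : Set (ℝ × ℝ)) (α β γ h : ι → ℝ), F.Finite ∧ F ⊆ C ∧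
      (∀ i, 1 ≤ α i ^ 2 + β i ^ 2 ∧ 0 < h i) ∧ ∑ i, h i < η ∧
      ∀ z ∈ C, z ∈ convexHull ℝ F ∨
        ∃ i, 0 ≤ α i * z.1 + β i * z.2 + γ i ∧ α i * z.1 + β i * z.2 + γ i ≤ h i := by
  obtain ⟨ι, _, F, α, β, γ, h, hF, hFC, hn, hsum, hcov⟩ :=
    exists_lower_polygon hC hM (half_pos hη)
  -- This reflection turns the upper boundary into a lower one.
  let R : ℝ × ℝ →ₗ[ℝ] ℝ × ℝ := LinearMap.prodMap LinearMap.id (-LinearMap.id)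
  have hR : ∀ z : ℝ × ℝ, R z = (z.1, -z.2) := fun z => rfl
  have hRR : ∀ z, R (R z) = z := fun z => by simp [hR]
  obtain ⟨ι', _, F', α', β', γ', h', hF', hFC', hn', hsum', hcov'⟩ :=
    exists_lower_polygon (hC.linear_preimage R) (M := M)
      (fun z hz => by simpa [hR] using hM _ hz) (half_pos hη)
  refine ⟨ι ⊕ ι', inferInstance, F ∪ R '' F', Sum.elim α α', Sum.elim β (fun i => -β' i),
    Sum.elim γ γ', Sum.elim h h', hF.union (hF'.image _), ?_, ?_, ?_, ?_⟩
  · refine Set.union_subset hFC ?_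
    rintro _ ⟨z, hz, rfl⟩
    exact hFC' hz
  · rintro (i | i)
    · exact hn i
    · simpa using hn' i
  · rw [Fintype.sum_sum_type]
    simp only [Sum.elim_inl, Sum.elim_inr]
    linarith
  · intro z hz
    rcases hcov z hz with ⟨y, hy, hyF⟩ | ⟨i, hi⟩
    · rcases hcov' (R z) (by simpa [hRR] using hz) with ⟨y', hy', hyF'⟩ | ⟨i, hi⟩
      · left
        have h1 : (z.1, y) ∈ convexHull ℝ (F ∪ R '' F') :=
          convexHull_mono Set.subset_union_left hyF
        have h2 : (z.1, -y') ∈ convexHull ℝ (F ∪ R '' F') := by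
          refine convexHull_mono Set.subset_union_right ?_
          rw [← R.image_convexHull]
          exact ⟨_, hyF', by simp [hR]⟩
        simp only [hR] at hy'
        refine (convex_convexHull ℝ _).segment_subset h1 h2 ?_
        rw [← Prod.image_mk_segment_right]
        refine ⟨z.2, ?_, rfl⟩
        rw [segment_eq_Icc (by linarith)]
        constructor <;> linarith
      · right
        refine ⟨Sum.inr i, ?_⟩
        simp only [hR] at hi
        simp only [Sum.elim_inr]
        constructor <;> linarith [hi.1, hi.2]
    · exact Or.inr ⟨Sum.inl i, hi⟩

/-! ### Slices at depth one -/

/-- One-dimensional analogue of `exists_polygon_strips`. -/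
lemma exists_segment_strips {C : Set ℝ} (hb : BddBelow C) (ha : BddAbove C) {η : ℝ} (hη : 0 < η) :
    ∃ (ι : Type) (_ : Fintype ι) (F : Set ℝ) (γ h : ι → ℝ), F.Finite ∧ F ⊆ C ∧
      (∀ i, 0 < h i) ∧ ∑ i, h i < η ∧
      ∀ s ∈ C, s ∈ convexHull ℝ F ∨ ∃ i, 0 ≤ s + γ i ∧ s + γ i ≤ h i := by
  rcases C.eq_empty_or_nonempty with rfl | hne
  · exact ⟨Empty, inferInstance, ∅, fun _ => 0, fun _ => 0,
      by simp, by simp, by simp, by simpa using hη, by simp⟩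
  obtain ⟨p, hp, hp'⟩ := exists_lt_of_csInf_lt hne (show sInf C < sInf C + η / 4 by linarith)
  obtain ⟨q, hq, hq'⟩ := exists_lt_of_lt_csSup hne (show sSup C - η / 4 < sSup C by linarith)
  refine ⟨Bool, inferInstance, {p, q}, fun c => if c then -sInf C else -(sSup C - η / 4),
    fun _ => η / 4, by simp, by simp [Set.insert_subset_iff, hp, hq], fun _ => by linarith, ?_, ?_⟩
  · simp; linarith
  · intro s hs
    have h1 := csInf_le hb hs
    have h2 := le_csSup ha hs
    rcases le_or_gt s (sInf C + η / 4) with h3 | h3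
    · refine Or.inr ⟨true, ?_⟩
      simp only [if_true]
      constructor <;> linarith
    rcases le_or_gt (sSup C - η / 4) s with h4 | h4
    · refine Or.inr ⟨false, ?_⟩
      simp only [Bool.false_eq_true, if_false]
      constructor <;> linarith
    · left
      rw [convexHull_pair, segment_eq_Icc (by linarith)]
      constructor <;> linarith

lemma add_map_mem_convexHull_image {E E' : Type*} [AddCommGroup E] [Module ℝ E] [AddCommGroup E']
    [Module ℝ E'] (L : E →ₗ[ℝ] E') (w : E') {F : Set E} {z : E} (hz : z ∈ convexHull ℝ F) :
    w + L z ∈ convexHull ℝ ((fun s => w + L s) '' F) :=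
  convexHull_min (t := (fun s => w + L s) ⁻¹' convexHull ℝ ((fun s => w + L s) '' F))
    (fun s hs => subset_convexHull ℝ _ ⟨s, hs, rfl⟩)
    (((convex_convexHull ℝ _).translate_preimage_right w).linear_preimage L) hz

/-- A bounded convex subset of an affine line or plane not through the origin is covered by the
convex hull of finitely many of its points and finitely many strips, given by linear functionals,
of arbitrarily small total width. -/
lemma exists_hull_strips_of_slice {d : ℕ} (hd : d = 2 ∨ d = 3) {u : EuclideanSpace ℝ (Fin d)}
    (hu : ‖u‖ = 1) {C : Set (EuclideanSpace ℝ (Fin d))} (hC : Convex ℝ C)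
    (hCu : ∀ v ∈ C, inner ℝ u v = -1) {M : ℝ} (hM : ∀ v ∈ C, ‖v‖ ≤ M) {η : ℝ} (hη : 0 < η) :
    ∃ (ι : Type) (_ : Fintype ι) (F : Set (EuclideanSpace ℝ (Fin d)))
      (n : ι → EuclideanSpace ℝ (Fin d)) (h : ι → ℝ), F.Finite ∧ F ⊆ C ∧
      (∀ i, 1 ≤ ‖n i‖ ∧ 0 < h i) ∧ ∑ i, h i < η ∧
      ∀ v ∈ C, v ∈ convexHull ℝ F ∨ ∃ i, 0 ≤ inner ℝ (n i) v ∧ inner ℝ (n i) v ≤ h i := by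
  rcases hd with rfl | rfl
  · obtain ⟨b, hb⟩ := Orthonormal.exists_orthonormalBasis_extension_of_card_eq (𝕜 := ℝ)
      (E := EuclideanSpace ℝ (Fin 2)) (ι := Fin 2) (by simp) (v := fun _ => u) (s := {0})
      (by
        rw [orthonormal_iff_ite]
        rintro ⟨i, hi⟩ ⟨j, hj⟩
        simp only [Set.mem_singleton_iff] at hi hj
        subst hi hj
        simp [hu])
    have hb0 : b 0 = u := hb 0 (by simp)
    have hrep : ∀ v ∈ C, v = -u + (inner ℝ (b 1) v) • b 1 := by
      intro v hv
      have := b.sum_repr' v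
      rw [Fin.sum_univ_two, hb0, hCu v hv] at this
      rw [← this]
      simp [inner_add_right, inner_smul_right, ← hb0]
    have habs : ∀ v ∈ C, |inner ℝ (b 1) v| ≤ M := fun v hv =>
      (abs_real_inner_le_norm _ _).trans (by simpa using hM v hv)
    obtain ⟨ι, _, F, γ, h, hF, hFC, hpos, hsum, hcov⟩ :=
      exists_segment_strips (C := (fun v => inner ℝ (b 1) v) '' C)
        ⟨-M, by rintro _ ⟨v, hv, rfl⟩; exact (abs_le.1 (habs v hv)).1⟩
        ⟨M, by rintro _ ⟨v, hv, rfl⟩; exact (abs_le.1 (habs v hv)).2⟩ hη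
    let L : ℝ →ₗ[ℝ] EuclideanSpace ℝ (Fin 2) := LinearMap.toSpanSingleton ℝ _ (b 1)
    have hL : ∀ s, L s = s • b 1 := fun s => rfl
    -- On the slice `inner ℝ u v = -1`, so subtracting `γ i • u` absorbs the constant and makes the
    -- affine functional linear.
    refine ⟨ι, inferInstance, (fun s => -u + L s) '' F, fun i => b 1 - γ i • u, h, hF.image _,
      ?_, fun i => ⟨?_, hpos i⟩, hsum, ?_⟩
    · rintro _ ⟨s, hs, rfl⟩
      obtain ⟨v, hv, rfl⟩ := hFC hs
      simp only [hL]
      rwa [← hrep v hv]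
    · have h1 : inner ℝ (b 1) (b 1 - γ i • u) = (1 : ℝ) := by
        simp [inner_sub_right, inner_smul_right, ← hb0]
      have := real_inner_le_norm (b 1) (b 1 - γ i • u)
      rw [h1] at this
      simpa using this
    · intro v hv
      rcases hcov _ ⟨v, hv, rfl⟩ with h1 | ⟨i, hi⟩
      · left
        have h3 := add_map_mem_convexHull_image L (-u) h1
        simp only [hL] at h3
        rwa [← hrep v hv] at h3
      · right
        refine ⟨i, ?_⟩
        have : inner ℝ (b 1 - γ i • u) v = inner ℝ (b 1) v + γ i := by
          simp [inner_sub_left, inner_smul_left, hCu v hv]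
        rw [this]
        exact hi
  · obtain ⟨b, hb⟩ := Orthonormal.exists_orthonormalBasis_extension_of_card_eq (𝕜 := ℝ)
      (E := EuclideanSpace ℝ (Fin 3)) (ι := Fin 3) (by simp) (v := fun _ => u) (s := {0})
      (by
        rw [orthonormal_iff_ite]
        rintro ⟨i, hi⟩ ⟨j, hj⟩
        simp only [Set.mem_singleton_iff] at hi hj
        subst hi hj
        simp [hu])
    have hb0 : b 0 = u := hb 0 (by simp)
    have hrep : ∀ v ∈ C, v = -u + ((inner ℝ (b 1) v) • b 1 + (inner ℝ (b 2) v) • b 2) := by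
      intro v hv
      have := b.sum_repr' v
      rw [Fin.sum_univ_three, hb0, hCu v hv, neg_one_smul, add_assoc] at this
      exact this.symm
    have habs : ∀ i, ∀ v ∈ C, |inner ℝ (b i) v| ≤ M := fun i v hv =>
      (abs_real_inner_le_norm _ _).trans (by simpa using hM v hv)
    let φ : EuclideanSpace ℝ (Fin 3) →ₗ[ℝ] ℝ × ℝ :=
      LinearMap.prod (innerₛₗ ℝ (b 1)) (innerₛₗ ℝ (b 2))
    have hφ : ∀ v, φ v = (inner ℝ (b 1) v, inner ℝ (b 2) v) := fun v => rfl
    obtain ⟨ι, _, F, α, β, γ, h, hF, hFC, hpos, hsum, hcov⟩ :=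
      exists_polygon_strips (hC.linear_image φ) (M := M)
        (by rintro _ ⟨v, hv, rfl⟩; exact ⟨habs 1 v hv, habs 2 v hv⟩) hη
    let L : ℝ × ℝ →ₗ[ℝ] EuclideanSpace ℝ (Fin 3) :=
      LinearMap.coprod (LinearMap.toSpanSingleton ℝ _ (b 1))
        (LinearMap.toSpanSingleton ℝ _ (b 2))
    have hL : ∀ z, L z = z.1 • b 1 + z.2 • b 2 := fun z => rfl
    refine ⟨ι, inferInstance, (fun s => -u + L s) '' F,
      fun i => α i • b 1 + β i • b 2 - γ i • u, h, hF.image _,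
      ?_, fun i => ⟨?_, (hpos i).2⟩, hsum, ?_⟩
    · rintro _ ⟨s, hs, rfl⟩
      obtain ⟨v, hv, rfl⟩ := hFC hs
      simp only [hL, hφ]
      rwa [← hrep v hv]
    · have h1 : ‖α i • b 1 + β i • b 2 - γ i • u‖ ^ 2 = α i ^ 2 + β i ^ 2 + γ i ^ 2 := by
        rw [← real_inner_self_eq_norm_sq, ← hb0]
        simp only [inner_sub_right, inner_add_right, inner_smul_right, inner_sub_left,
          inner_add_left, inner_smul_left, b.inner_eq_ite]
        simp
        ring
      have h2 := (hpos i).1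
      by_contra! h3
      nlinarith [norm_nonneg (α i • b 1 + β i • b 2 - γ i • u), sq_nonneg (γ i)]
    · intro v hv
      rcases hcov _ ⟨v, hv, rfl⟩ with h1 | ⟨i, hi⟩
      · left
        have h3 := add_map_mem_convexHull_image L (-u) h1
        simp only [hL, hφ] at h3
        rwa [← hrep v hv] at h3
      · right
        refine ⟨i, ?_⟩
        have : inner ℝ (α i • b 1 + β i • b 2 - γ i • u) v =
            α i * inner ℝ (b 1) v + β i * inner ℝ (b 2) v + γ i := by
          simp [inner_sub_left, inner_add_left, inner_smul_left, hCu v hv]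
        rw [this]
        exact hi

open Filter Topology

/-! ### The cone at the tip and its interior directions -/

/-- A spiky body lies, near its tip, in a cone that meets the supporting hyperplane only in its
apex. -/
lemma exists_mul_norm_le_of_tangentCone {d : ℕ} {K : Set (EuclideanSpace ℝ (Fin d))}
    {u x : EuclideanSpace ℝ (Fin d)} (hx : inner ℝ x u = supportFunction K u)
    (hle : ∀ k ∈ K, inner ℝ k u ≤ inner ℝ x u)
    (hT : tangentConeOf K x ∩ supportingHyperplane K u = {x}) :
    ∃ c > 0, ∀ k ∈ K, c * ‖k - x‖ ≤ inner ℝ (x - k) u := by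
  -- Depth is positive on this compact set by spikiness; its minimum there is `c`, by homogeneity.
  have hcompact : IsCompact (Metric.sphere x 1 ∩ tangentConeOf K x) :=
    (isCompact_sphere x 1).inter_right isClosed_closure
  have hcont : Continuous fun z : EuclideanSpace ℝ (Fin d) => (inner ℝ (x - z) u : ℝ) := by
    fun_prop
  have hnn : ∀ z ∈ tangentConeOf K x, 0 ≤ inner ℝ (x - z) u := by
    have : tangentConeOf K x ⊆ {z | 0 ≤ inner ℝ (x - z) u} := by
      refine closure_minimal ?_ (isClosed_le continuous_const hcont)
      rintro _ ⟨y, hy, α, hα, rfl⟩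
      have h1 := hle y hy
      have h2 : inner ℝ (x - (x + α • (y - x))) u = α * (inner ℝ x u - inner ℝ y u) := by
        simp [inner_sub_left, inner_smul_left]
        ring
      show 0 ≤ inner ℝ (x - (x + α • (y - x))) u
      rw [h2]
      exact mul_nonneg hα (by linarith)
    exact this
  have hmem : ∀ k ∈ K, k ≠ x → x + ‖k - x‖⁻¹ • (k - x) ∈
      Metric.sphere x 1 ∩ tangentConeOf K x := by
    intro k hk hkx
    have h0 : ‖k - x‖ ≠ 0 := norm_ne_zero_iff.2 (sub_ne_zero.2 hkx)
    refine ⟨?_, subset_closure ⟨k, hk, _, by positivity, rfl⟩⟩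
    simp [norm_smul, h0]
  rcases (Metric.sphere x 1 ∩ tangentConeOf K x).eq_empty_or_nonempty with hemp | hne
  · refine ⟨1, one_pos, fun k hk => ?_⟩
    by_cases hkx : k = x
    · simp [hkx]
    · have := hmem k hk hkx
      simp [hemp] at this
  obtain ⟨z, hz, hmin⟩ := hcompact.exists_isMinOn hne hcont.continuousOn
  refine ⟨inner ℝ (x - z) u, ?_, fun k hk => ?_⟩
  · refine lt_of_le_of_ne (hnn z hz.2) fun h0 => ?_
    have : z ∈ tangentConeOf K x ∩ supportingHyperplane K u := by
      refine ⟨hz.2, ?_⟩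
      show inner ℝ z u = supportFunction K u
      rw [inner_sub_left] at h0
      linarith
    rw [hT] at this
    have h1 := hz.1
    rw [Set.mem_singleton_iff.1 this] at h1
    simp at h1
  · by_cases hkx : k = x
    · simp [hkx]
    · have h1 := hmin (hmem k hk hkx)
      have h0 : 0 < ‖k - x‖ := norm_pos_iff.2 (sub_ne_zero.2 hkx)
      have h2 : inner ℝ (x - (x + ‖k - x‖⁻¹ • (k - x))) u = ‖k - x‖⁻¹ * inner ℝ (x - k) u := by
        rw [← real_inner_smul_left]
        congr 1
        module
      simp only [Set.mem_ofPred_eq] at h1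
      rw [h2, inv_mul_eq_div, le_div_iff₀ h0] at h1
      exact h1

/-- If a positive multiple of `f` is interior to a convex set `A` containing the origin, then
small multiples of `f`, also when pushed slightly away from `p`, lie in `A`. -/
lemma eventually_smul_mem_and_sub_mem {E : Type*} [NormedAddCommGroup E] [NormedSpace ℝ E]
    {A : Set E} (hA : Convex ℝ A) (h0 : (0 : E) ∈ A) {f : E} {α : ℝ} (hα : 0 < α)
    (hf : α • f ∈ interior A) (p : E) :
    ∀ᶠ δ : ℝ in 𝓝[>] 0, δ • f ∈ A ∧ δ • f - δ ^ 2 • p ∈ A := by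
  -- Scaling this point by `δ / α` gives `δ • f - δ ^ 2 • p`; the push is of smaller order than `δ`.
  have hcont : Continuous fun δ : ℝ => α • f - (α * δ) • p := by fun_prop
  have h1 : ∀ᶠ δ : ℝ in 𝓝 0, α • f - (α * δ) • p ∈ A := by
    have := hcont.tendsto 0
    simp only [mul_zero, zero_smul, sub_zero] at this
    exact this (mem_interior_iff_mem_nhds.1 hf)
  have h2 : ∀ᶠ δ : ℝ in 𝓝 0, δ < α := eventually_lt_nhds hα
  filter_upwards [nhdsWithin_le_nhds h1, nhdsWithin_le_nhds h2, self_mem_nhdsWithin]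
    with δ h1 h2 (h3 : 0 < δ)
  have hq : δ / α ≤ 1 := (div_le_one hα).2 h2.le
  have hq0 : 0 ≤ δ / α := by positivity
  constructor
  · have := hA.smul_mem_of_zero_mem h0 (interior_subset hf) ⟨hq0, hq⟩
    rwa [smul_smul, div_mul_cancel₀ _ hα.ne'] at this
  · have := hA.smul_mem_of_zero_mem h0 h1 ⟨hq0, hq⟩
    rw [smul_sub, smul_smul, smul_smul, div_mul_cancel₀ _ hα.ne'] at this
    convert this using 3
    field_simp

lemma Plank.isClosed_region {d : ℕ} (P : Plank d) : IsClosed P.region := by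
  have hcont : Continuous fun x : EuclideanSpace ℝ (Fin d) => (inner ℝ P.normal x : ℝ) := by
    fun_prop
  exact (isClosed_le continuous_const hcont).inter (isClosed_le hcont continuous_const)

/-- The directions, normalised to depth one, pointing from the origin into the interior of a
convex set form a convex set. -/
lemma convex_depth_one_slice {d : ℕ} {A : Set (EuclideanSpace ℝ (Fin d))} (hA : Convex ℝ A)
    (u : EuclideanSpace ℝ (Fin d)) :
    Convex ℝ {v | inner ℝ u v = (-1 : ℝ) ∧ ∃ α : ℝ, 0 < α ∧ α • v ∈ interior A} := by
  rintro v ⟨hv, α, hα, hvA⟩ v' ⟨hv', β, hβ, hvA'⟩ a b ha hb hab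
  refine ⟨by simp [inner_add_right, inner_smul_right, hv, hv']; linarith, ?_⟩
  have hpos : 0 < a * β + b * α := by
    rcases ha.eq_or_lt with rfl | ha
    · have : b = 1 := by linarith
      subst this
      simpa using hα
    · have := mul_pos ha hβ
      positivity
  -- A weighted harmonic mean of `α` and `β`, which makes the point a convex combination of `α • v`
  -- and `β • v'`.
  refine ⟨α * β / (a * β + b * α), by positivity, ?_⟩
  have := hA.interior hvA hvA' (a := a * β / (a * β + b * α)) (b := b * α / (a * β + b * α))
    (by positivity) (by positivity) (by field_simp)
  convert this using 1
  rw [smul_add, smul_smul, smul_smul, smul_smul, smul_smul]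
  congr 2 <;> field_simp

/-! ### Covering the annulus -/

/-- Covering the annulus between a spiky convex body with tip at the origin and a small homothetic
copy pushed slightly inwards: every interior point outside the copy is deep, or very close to the
tip, or in one of finitely many thin strips. -/
lemma exists_annulus_strips {d : ℕ} (hd : d = 2 ∨ d = 3) {A : Set (EuclideanSpace ℝ (Fin d))}
    (hA : Convex ℝ A) (h0 : (0 : EuclideanSpace ℝ (Fin d)) ∈ A)
    {u p : EuclideanSpace ℝ (Fin d)} (hu : ‖u‖ = 1) {c : ℝ} (hc : 0 < c)
    (hcone : ∀ a ∈ A, c * ‖a‖ ≤ -inner ℝ u a) {w ε : ℝ} (hw : 0 < w) (hε0 : 0 < ε)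
    (hε1 : ε < 1) :
    ∃ (σ t r : ℝ) (ι : Type) (_ : Fintype ι) (n : ι → EuclideanSpace ℝ (Fin d)) (h : ι → ℝ),
      0 < σ ∧ σ ≤ 1 - ε ∧ t < w ∧ 0 < r ∧ (∀ i, 1 ≤ ‖n i‖ ∧ 0 < h i) ∧
      (w - t) + r + ∑ i, h i < w ∧
      ∀ v ∈ interior A, t ≤ -inner ℝ u v ∨ -inner ℝ u v ≤ r ∨
        (∃ i, 0 ≤ inner ℝ (n i) v ∧ inner ℝ (n i) v ≤ h i) ∨ ∃ a ∈ A, v = σ • p + ε • a := by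
  set C := {v : EuclideanSpace ℝ (Fin d) |
    inner ℝ u v = (-1 : ℝ) ∧ ∃ α : ℝ, 0 < α ∧ α • v ∈ interior A} with hCdef
  have hCM : ∀ v ∈ C, ‖v‖ ≤ c⁻¹ := by
    rintro v ⟨hv, α, hα, hvA⟩
    have h1 := hcone _ (interior_subset hvA)
    rw [inner_smul_right, hv, norm_smul, Real.norm_of_nonneg hα.le] at h1
    have h2 : α * (c * ‖v‖) ≤ α * 1 := by linarith
    have h3 := le_of_mul_le_mul_left h2 hα
    rw [← one_div, le_div_iff₀ hc]
    linarith
  obtain ⟨ι, _, F, n, h, hF, hFC, hn, hsum, hcov⟩ := exists_hull_strips_of_slice hd hu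
    (convex_depth_one_slice hA u) (fun v hv => hv.1) hCM (half_pos one_pos)
  obtain ⟨δ, hδF, hδ⟩ : ∃ δ : ℝ, (∀ f ∈ F, δ • f ∈ A ∧ δ • f - δ ^ 2 • p ∈ A) ∧ 0 < δ := by
    have h1 : ∀ᶠ δ : ℝ in 𝓝[>] 0, ∀ f ∈ F, δ • f ∈ A ∧ δ • f - δ ^ 2 • p ∈ A := by
      rw [Filter.eventually_all_finite hF]
      intro f hf
      obtain ⟨-, α, hα, hfA⟩ := hFC hf
      exact eventually_smul_mem_and_sub_mem hA h0 hα hfA p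
    exact (h1.and self_mem_nhdsWithin).exists
  have hhull : ∀ f ∈ convexHull ℝ F, δ • f ∈ A ∧ δ • f - δ ^ 2 • p ∈ A := by
    have hconv : Convex ℝ {f | δ • f ∈ A ∧ δ • f - δ ^ 2 • p ∈ A} := by
      rintro f ⟨hf, hf'⟩ g ⟨hg, hg'⟩ a b ha hb hab
      have h1 := hA hf hg ha hb hab
      have h2 := hA hf' hg' ha hb hab
      obtain rfl : a = 1 - b := by linarith
      refine ⟨?_, ?_⟩
      · show δ • ((1 - b) • f + b • g) ∈ A
        convert h1 using 1; module
      · show δ • ((1 - b) • f + b • g) - δ ^ 2 • p ∈ A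
        convert h2 using 1; module
    exact fun f hf => convexHull_min (fun f hf => hδF f hf) hconv hf
  -- `t ≤ ε * δ` lets points of depth below `t` be reached from scale `δ` after division by `ε`.
  set t := min (ε * δ) (w / 2) with ht
  have htpos : 0 < t := lt_min (by positivity) (by positivity)
  have htε : t ≤ ε * δ := min_le_left _ _
  have htw : t < w := (min_le_right _ _).trans_lt (by linarith)
  -- The first bound makes the tip plank at most `t / 4` wide; the second keeps the pushed copy
  -- inside the body.
  set σ := min (δ * t / 4) (1 - ε) with hσ
  have hσpos : 0 < σ := lt_min (by positivity) (by linarith)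
  have hσt : σ / δ ≤ t / 4 := by
    rw [div_le_iff₀ hδ]
    have : σ ≤ δ * t / 4 := min_le_left _ _
    linarith
  refine ⟨σ, t, σ / δ, ι, inferInstance, n, fun i => t * h i, hσpos, min_le_right _ _, htw,
    by positivity, fun i => ⟨(hn i).1, mul_pos htpos (hn i).2⟩, ?_, ?_⟩
  · rw [← Finset.mul_sum]
    nlinarith
  intro v hv
  by_cases h1 : t ≤ -inner ℝ u v
  · exact Or.inl h1
  by_cases h2 : -inner ℝ u v ≤ σ / δ
  · exact Or.inr (Or.inl h2)
  refine Or.inr (Or.inr ?_)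
  push Not at h1 h2
  obtain ⟨D, hD⟩ : ∃ D, D = -inner ℝ u v := ⟨_, rfl⟩
  rw [← hD] at h1 h2
  have hDpos : 0 < D := lt_trans (by positivity) h2
  have hvC : D⁻¹ • v ∈ C := by
    refine ⟨?_, D, hDpos, ?_⟩
    · rw [inner_smul_right, show inner ℝ u v = -D by linarith]
      field_simp
    · rwa [smul_smul, mul_inv_cancel₀ hDpos.ne', one_smul]
  rcases hcov _ hvC with h3 | ⟨i, hi⟩
  · right
    obtain ⟨h4, h5⟩ := hhull _ h3
    obtain ⟨f, hf⟩ : ∃ f, f = D⁻¹ • v := ⟨_, rfl⟩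
    have hvf : v = D • f := by rw [hf, smul_smul, mul_inv_cancel₀ hDpos.ne', one_smul]
    rw [← hf] at h4 h5
    have hθ : σ / (D * δ) ≤ 1 := by
      rw [div_le_one (by positivity)]
      rw [div_lt_iff₀ hδ] at h2
      exact h2.le
    -- This combination is `δ • f - (σ * δ / D) • p`; its weight is at most `1` because the depth
    -- `D` exceeds `σ / δ`. Shrinking by `D / (ε * δ)` and multiplying by `ε` yields `v - σ • p`.
    have h6 := hA h4 h5 (a := 1 - σ / (D * δ)) (b := σ / (D * δ)) (by linarith)
      (by positivity) (by ring)
    have h7 := hA.smul_mem_of_zero_mem h0 h6 (t := D / (ε * δ))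
      ⟨by positivity, (div_le_one (by positivity)).2 (by linarith)⟩
    refine ⟨_, h7, ?_⟩
    have h8 : (1 - σ / (D * δ)) • δ • f + (σ / (D * δ)) • (δ • f - δ ^ 2 • p) =
        δ • f - (σ * δ / D) • p := by
      have : σ * δ / D = σ / (D * δ) * δ ^ 2 := by field_simp
      rw [this]
      module
    rw [h8, smul_smul, smul_sub, smul_smul, smul_smul, hvf]
    have e1 : ε * (D / (ε * δ)) * δ = D := by field_simp
    have e2 : ε * (D / (ε * δ)) * (σ * δ / D) = σ := by field_simp
    rw [e1, e2]
    module
  · left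
    refine ⟨i, ?_⟩
    rw [inner_smul_right] at hi
    have hvi : inner ℝ (n i) v = D * (D⁻¹ * inner ℝ (n i) v) := by field_simp
    rw [hvi]
    exact ⟨mul_nonneg hDpos.le hi.1,
      mul_le_mul h1.le hi.2 hi.1 htpos.le⟩

theorem theorem2 (d : ℕ) (hd : d = 2 ∨ d = 3)
    (K : ConvexBody (EuclideanSpace ℝ (Fin d)))
    (hK : (interior (K : Set (EuclideanSpace ℝ (Fin d)))).Nonempty)
    (hspiky : ∃ u : EuclideanSpace ℝ (Fin d),
      IsMinimalWidthDirection (K : Set (EuclideanSpace ℝ (Fin d))) u ∧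
        IsSpiky (K : Set (EuclideanSpace ℝ (Fin d))) u)
    (ε : ℝ) (hε0 : 0 < ε) (hε1 : ε < 1) :
    ∃ y : EuclideanSpace ℝ (Fin d),
      homotheticCopy (K : Set (EuclideanSpace ℝ (Fin d))) ε y ⊆
          interior (K : Set (EuclideanSpace ℝ (Fin d))) ∧
        ∃ (n : ℕ) (P : Fin n → Plank d),
          (K : Set (EuclideanSpace ℝ (Fin d))) \
              homotheticCopy (K : Set (EuclideanSpace ℝ (Fin d))) ε y ⊆ ⋃ i, (P i).region ∧
            ∑ i, (P i).width < minimalWidth (K : Set (EuclideanSpace ℝ (Fin d))) := by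
  obtain ⟨u, ⟨Q, ⟨hKQ, hQw⟩, hQu⟩, hu, x, -, hxK, hT⟩ := hspiky
  obtain ⟨w, hw⟩ : ∃ w, w = minimalWidth (K : Set (EuclideanSpace ℝ (Fin d))) := ⟨_, rfl⟩
  rw [← hw] at hQw ⊢
  have hwpos : 0 < w := by rw [← hQw]; exact sub_pos.2 Q.lower_lt_upper
  have hconv := K.convex
  have hcomp := K.isCompact
  generalize (K : Set (EuclideanSpace ℝ (Fin d))) = S at *
  have hbounds : ∀ k ∈ S, Q.lower ≤ inner ℝ u k ∧ inner ℝ u k ≤ Q.upper := fun k hk =>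
    hQu ▸ hKQ hk
  obtain ⟨hxS, hxu⟩ : x ∈ S ∩ supportingHyperplane S u := hxK ▸ rfl
  have hle : ∀ k ∈ S, inner ℝ k u ≤ inner ℝ x u := by
    intro k hk
    rw [show inner ℝ x u = supportFunction S u from hxu]
    refine le_csSup ⟨Q.upper, ?_⟩ ⟨k, hk, rfl⟩
    rintro _ ⟨k', hk', rfl⟩
    simpa only [real_inner_comm] using (hbounds k' hk').2
  obtain ⟨c, hc, hcone⟩ := exists_mul_norm_le_of_tangentCone hxu hle hT
  set A := (fun v => x + v) ⁻¹' S with hAdef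
  have hA : Convex ℝ A := hconv.translate_preimage_right x
  have h0 : (0 : EuclideanSpace ℝ (Fin d)) ∈ A := by simpa [hAdef] using hxS
  have hAint : ∀ v, v ∈ interior A ↔ x + v ∈ interior S := fun v => by
    have := (Homeomorph.addLeft x).preimage_interior S
    exact (Set.ext_iff.1 this v).symm
  obtain ⟨q, hq⟩ := hK
  obtain ⟨p, rfl⟩ : ∃ p, q = x + p := ⟨q - x, by abel⟩
  obtain ⟨σ, t, r, ι, _, n, h, hσ, hσε, htw, hr, hn, hsum, hcov⟩ :=
    exists_annulus_strips hd hA h0 (p := p) hu hc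
      (fun a ha => by
        have := hcone _ ha
        rw [add_sub_cancel_left, sub_add_cancel_left, inner_neg_left, real_inner_comm] at this
        exact this) hwpos hε0 hε1
  -- The copy then has its tip at `x + σ • p`, and `x + a` goes to `x + σ • p + ε • a`.
  refine ⟨x + σ • p - ε • x, ?_, ?_⟩
  · rintro _ ⟨k, hk, rfl⟩
    obtain ⟨a, rfl⟩ : ∃ a, k = x + a := ⟨k - x, by abel⟩
    have h1 : (ε / (1 - σ)) • a ∈ A := hA.smul_mem_of_zero_mem h0 hk
      ⟨div_nonneg hε0.le (by linarith), (div_le_one (by linarith)).2 (by linarith)⟩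
    have h2 := hA.combo_interior_self_mem_interior ((hAint p).2 hq) h1 hσ
      (show 0 ≤ 1 - σ by linarith) (by ring)
    rw [smul_smul, mul_div_cancel₀ _ (show (1 - σ) ≠ 0 by linarith), hAint] at h2
    convert h2 using 1
    module
  -- Covering interior points suffices: the planks and the copy are closed, and the interior is
  -- dense in the body.
  suffices hfin : ∃ (P : Bool ⊕ ι → Plank d),
      interior S \ homotheticCopy S ε (x + σ • p - ε • x) ⊆ ⋃ i, (P i).region ∧
        ∑ i, (P i).width < w by
    obtain ⟨P, hP, hPw⟩ := hfin
    let e := Fintype.equivFin (Bool ⊕ ι)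
    refine ⟨_, P ∘ e.symm, ?_, ?_⟩
    · have hcl : IsClosed (⋃ i, (P i).region) := isClosed_iUnion_of_finite fun i =>
        (P i).isClosed_region
      have hcopy : IsClosed (homotheticCopy S ε (x + σ • p - ε • x)) :=
        (hcomp.image (by fun_prop)).isClosed
      have hunion : ⋃ i, ((P ∘ e.symm) i).region = ⋃ i, (P i).region :=
        e.symm.surjective.iUnion_comp fun i => (P i).region
      rw [hunion]
      rintro z ⟨hz, hz'⟩
      have h1 : z ∈ closure (interior S) := by
        rw [hconv.closure_interior_eq_closure_of_nonempty_interior ⟨_, hq⟩]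
        exact subset_closure hz
      refine closure_minimal hP hcl (closure_mono ?_ (hcopy.isOpen_compl.inter_closure ⟨hz', h1⟩))
      exact fun z hz => ⟨hz.2, hz.1⟩
    · have := e.symm.sum_comp fun i => (P i).width
      simpa only [Function.comp_apply, this] using hPw
  have hnpos : ∀ i, 0 < ‖n i‖ := fun i => one_pos.trans_le (hn i).1
  refine ⟨Sum.elim
    (fun b => if b then ⟨u, inner ℝ u x - w, inner ℝ u x - t, hu, by linarith⟩
      else ⟨u, inner ℝ u x - r, inner ℝ u x, hu, by linarith⟩)
    (fun i => ⟨‖n i‖⁻¹ • n i, ‖n i‖⁻¹ * inner ℝ (n i) x, ‖n i‖⁻¹ * (inner ℝ (n i) x + h i),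
      by simp [norm_smul, (hnpos i).ne'],
      mul_lt_mul_of_pos_left (by linarith [(hn i).2]) (inv_pos.2 (hnpos i))⟩), ?_, ?_⟩
  · rintro z ⟨hz, hz'⟩
    obtain ⟨v, rfl⟩ : ∃ v, z = x + v := ⟨z - x, by abel⟩
    rw [Set.mem_iUnion]
    have hzle := hle _ (interior_subset hz)
    rw [real_inner_comm, real_inner_comm u x, inner_add_right] at hzle
    have hzb := hbounds _ (interior_subset hz)
    have hxb := hbounds _ hxS
    have hwQ : Q.upper - Q.lower = w := hQw
    rcases hcov v ((hAint v).2 hz) with h1 | h1 | ⟨i, hi1, hi2⟩ | ⟨a, ha, rfl⟩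
    · refine ⟨Sum.inl true, ?_⟩
      rw [inner_add_right] at hzb
      simp only [Sum.elim_inl, if_true, Plank.region, Set.mem_ofPred_eq, inner_add_right]
      constructor <;> linarith
    · refine ⟨Sum.inl false, ?_⟩
      simp only [Sum.elim_inl, Bool.false_eq_true, if_false, Plank.region, Set.mem_ofPred_eq,
        inner_add_right]
      constructor <;> linarith
    · refine ⟨Sum.inr i, ?_⟩
      simp only [Sum.elim_inr, Plank.region, Set.mem_ofPred_eq, inner_smul_left, inner_add_right]
      have := inv_nonneg.2 (hnpos i).le
      constructor <;> refine mul_le_mul_of_nonneg_left (by linarith) (by simp)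
    · refine (hz' ⟨x + a, ha, ?_⟩).elim
      simp only
      module
  · rw [Fintype.sum_sum_type]
    refine lt_of_le_of_lt ?_ hsum
    refine add_le_add (le_of_eq ?_) (Finset.sum_le_sum fun i _ => ?_)
    · simp [Plank.width]
      ring
    · simp only [Sum.elim_inr, Plank.width]
      rw [← mul_sub, add_sub_cancel_left]
      -- Normalising the normals only shrinks widths, since `1 ≤ ‖n i‖`.
      exact mul_le_of_le_one_left (hn i).2.le (inv_le_one_of_one_le₀ (hn i).1)
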